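/- There is an absolute constant $c>0$ such that the following holds for all integers $d\ge 1$, $n\ge 1$ and all real $q\ge 1$. For an order-$d$ tensor $\mathcal T\in\mathbb R^{n\times\cdots\times n}$ let $$\|\mathcal T\|_2=\sup\Big\{\Big|\sum_{i_1,\dots,i_d=1}^n \mathcal T_{i_1\dots i_d}\,(x_1)_{i_1}\cdots (x_d)_{i_d}\Big| : x_1,\dots,x_d\in\mathbb R^n,\ \text{each of Euclidean norm } 1\Big\}$$ be its spectral norm. Let $\mathcal A$ be a random order-$d$ tensor in $\mathbb R^{n\times\cdots\times n}$ whose entries are independent integrable random variables, and let $\widehat{\mathcal A}=\mathbb E\mathcal A$ be its entrywise mean. Then $$\big(\mathbb E\|\mathcal A-\widehat{\mathcal A}\|_2^q\big)^{1/q}\le c\,2^{3(d-1)}\big(\sqrt{d\ln n}+\sqrt q\big)\Big(\sum_{j=1}^d \mathbb E\max_{i_1,\dots,i_{j-1},i_{j+1},\dots,i_d}\Big(\sum_{i_j=1}^n\mathcal A_{i_1\dots i_d}^2\Big)^{q/2}\Big)^{1/q},$$ where both sides are understood as elements of $[0,\infty]$. -/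

import Mathlib

open MeasureTheory ProbabilityTheory

/-- Real tensors of order `d` with all `d` dimensions equal to `n`, given by their entries. -/
abbrev RealTensor (d n : ℕ) : Type := (Fin d → Fin n) → ℝ

namespace RealTensor

/-- The full tensor-vector product `T ×₁ x₁ ×₂ x₂ ⋯ ×_d x_d`. -/
noncomputable def vecProd {d n : ℕ} (T : RealTensor d n)
    (x : Fin d → EuclideanSpace ℝ (Fin n)) : ℝ :=
  ∑ i : Fin d → Fin n, T i * ∏ k : Fin d, x k (i k)

/-- The spectral norm: the supremum of `|T ×₁ x₁ ⋯ ×_d x_d|` over Euclidean unit vectors. -/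
noncomputable def spectralNorm {d n : ℕ} (T : RealTensor d n) : ℝ :=
  sSup {r : ℝ | ∃ x : Fin d → EuclideanSpace ℝ (Fin n), (∀ k, ‖x k‖ = 1) ∧ r = |T.vecProd x|}

/-- The set whose supremum is the spectral norm is bounded. -/
theorem bddAbove_spectralNorm {d n : ℕ} (T : RealTensor d n) :
    BddAbove {r : ℝ | ∃ x : Fin d → EuclideanSpace ℝ (Fin n),
      (∀ k, ‖x k‖ = 1) ∧ r = |T.vecProd x|} := by
  refine ⟨∑ i, |T i|, ?_⟩
  rintro r ⟨x, hx, rfl⟩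
  refine (Finset.abs_sum_le_sum_abs _ _).trans (Finset.sum_le_sum fun i _ => ?_)
  rw [abs_mul, Finset.abs_prod]
  refine mul_le_of_le_one_right (abs_nonneg _) (Finset.prod_le_one (fun _ _ => abs_nonneg _) ?_)
  intro k _
  have h := PiLp.norm_apply_le (x k) (i k)
  rwa [hx k, Real.norm_eq_abs] at h

/-- The maximum, over all mode-`j` fibres of `T`, of `(∑_{i_j} T_{i_1 ⋯ i_d} ^ 2) ^ (q / 2)`.
A fibre is named by any multi-index `i` on it; the value of `i` at `j` plays no role. -/
noncomputable def maxFibre {d n : ℕ} (T : RealTensor d n) (q : ℝ) (j : Fin d) : ℝ :=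
  ⨆ i : Fin d → Fin n, (∑ t : Fin n, T (Function.update i j t) ^ 2) ^ (q / 2)

end RealTensor

/-! The proof is a symmetrization followed by a chaining bound for a tensor with random signs. Since
`Ahat` is the mean of an independent copy of `A`, Jensen's inequality replaces it by that copy.
Exchanging individual entries of the two copies preserves their joint law, so the entries of the
difference may be given arbitrary signs. It remains to bound, for a fixed tensor, the `q`-th moment
over the signs by the fibre norms (`sum_gridNorm_boolSign_rpow_le`). The form is affine in each
coordinate of each vector, so every coordinate may be pushed to a neighbouring value `0` or `± 2⁻ˡ`,
at the price of norm `√5` instead of `1` (`spectralNorm_le_gridNorm`). A plain union bound over such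
vectors is too costly. Each rank-one grid tensor is split according to the smallest absolute value
`2⁻ˡ` among its factors and the first mode `j` where it occurs. In part `(j, l)` the entries of mode
`j` are exactly `± 2⁻ˡ`, so the variance weighted by `4ˡ` sums over `l` to a mode-`j` fibre bound.
The entropy is `log n` times the number of entries of size at least `2⁻ˡ`, and weighted by `4⁻ˡ` it
sums to a multiple of the squared norms. By Cauchy–Schwarz the levels together cost only `√(d log (n
+ 1) + d + q)` up to a constant, with no extra logarithm. The maximal inequality
`exists_uniform_bound_rademacher` handles all parts at once with a single random factor. -/

/-! ### Rademacher sums and a penalized maximal inequality -/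

/-- The sign encoded by a Boolean. -/
def boolSign (b : Bool) : ℝ := if b then 1 else -1

theorem sum_exp_boolSign_le {ι : Type*} [Fintype ι] [DecidableEq ι] (b : ι → ℝ) :
    ∑ ε : ι → Bool, Real.exp (∑ i, boolSign (ε i) * b i) ≤
      2 ^ Fintype.card ι * Real.exp ((∑ i, b i ^ 2) / 2) := by
  have h : ∑ ε : ι → Bool, Real.exp (∑ i, boolSign (ε i) * b i) = ∏ i, (2 * Real.cosh (b i)) := by
    simp_rw [Real.exp_sum]
    rw [← Fintype.prod_sum (fun i (s : Bool) => Real.exp (boolSign s * b i))]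
    refine Finset.prod_congr rfl fun i _ => ?_
    simp [boolSign, Real.cosh_eq]
    ring
  rw [h, Finset.prod_mul_distrib, Finset.prod_const, Finset.card_univ, Finset.sum_div, Real.exp_sum]
  refine mul_le_mul_of_nonneg_left ?_ (by positivity)
  exact Finset.prod_le_prod (fun i _ => (Real.cosh_pos _).le) fun i _ =>
    Real.cosh_le_exp_half_sq _

theorem sum_exp_mul_boolSign_sub_le {ι : Type*} [Fintype ι] [DecidableEq ι] (b : ι → ℝ) (s : ℝ) :
    ∑ ε : ι → Bool, Real.exp (s * (∑ i, boolSign (ε i) * b i) - s ^ 2 * (∑ i, b i ^ 2) / 2) ≤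
      2 ^ Fintype.card ι := by
  have h := sum_exp_boolSign_le (fun i => s * b i)
  have h2 : ∀ ε : ι → Bool, ∑ i, boolSign (ε i) * (s * b i) = s * ∑ i, boolSign (ε i) * b i := by
    intro ε
    rw [Finset.mul_sum]
    exact Finset.sum_congr rfl fun i _ => by ring
  simp_rw [h2, mul_pow, ← Finset.mul_sum] at h
  simp_rw [Real.exp_sub, ← Finset.sum_div]
  rwa [div_le_iff₀ (Real.exp_pos _)]

/-- A penalized maximal inequality for finitely many Rademacher sums: outside of the factor `G`,
whose `q`-th moment is controlled, every sum is bounded by its standard deviation times the square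
root of its penalty. -/
theorem exists_uniform_bound_rademacher {ι Z : Type*} [Fintype ι] [DecidableEq ι] [Fintype Z] (b : Z → ι → ℝ)
    (h : Z → ℝ) (h0 : ∀ z, 0 ≤ h z) (hsum : ∑ z, Real.exp (-h z) ≤ 1) {q : ℝ} (hq : 1 ≤ q) :
    ∃ G : (ι → Bool) → ℝ, (∀ ε, 0 ≤ G ε) ∧
      (∑ ε, G ε ^ q ≤ 3 * 2 ^ q * 2 ^ Fintype.card ι) ∧
      ∀ ε z, |∑ i, boolSign (ε i) * b z i| ≤
        G ε * (Real.sqrt (∑ i, b z i ^ 2) * Real.sqrt (h z + q)) := by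
  have hq0 : 0 < q := by linarith
  set V : Z → ℝ := fun z => ∑ i, b z i ^ 2 with hV
  set X : (ι → Bool) → Z → ℝ := fun ε z => ∑ i, boolSign (ε i) * b z i with hX
  -- This choice makes `s² V = h + q` when `V > 0`, so the Gaussian correction in `Φ` is comparable
  -- to the penalty.
  set s : Z → ℝ := fun z => Real.sqrt (h z + q) / Real.sqrt (V z) with hs
  set Φ : (ι → Bool) → ℝ := fun ε => ∑ z, Real.exp (-h z) *
    (Real.exp (s z * X ε z - s z ^ 2 * V z / 2) +
      Real.exp (-s z * X ε z - (-s z) ^ 2 * V z / 2)) with hΦ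
  have hΦ0 : ∀ ε, 0 ≤ Φ ε := fun ε => Finset.sum_nonneg fun z _ => by positivity
  have hΦsum : ∑ ε, Φ ε ≤ 2 * 2 ^ Fintype.card ι := by
    simp only [hΦ]
    rw [Finset.sum_comm]
    calc _ ≤ ∑ z, Real.exp (-h z) * (2 * 2 ^ Fintype.card ι) := by
          refine Finset.sum_le_sum fun z _ => ?_
          rw [← Finset.mul_sum, Finset.sum_add_distrib]
          refine mul_le_mul_of_nonneg_left ?_ (Real.exp_pos _).le
          have h1 := sum_exp_mul_boolSign_sub_le (b z) (s z)
          have h2 := sum_exp_mul_boolSign_sub_le (b z) (-s z)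
          simp only [hX, hV]
          linarith
      _ ≤ _ := by
          rw [← Finset.sum_mul]
          exact mul_le_of_le_one_left (by positivity) hsum
  refine ⟨fun ε => 2 * (1 + Φ ε) ^ (1 / q), fun ε => ?_, ?_, fun ε z => ?_⟩
  · have := hΦ0 ε
    positivity
  · have h1 : ∀ ε, (2 * (1 + Φ ε) ^ (1 / q)) ^ q = 2 ^ q * (1 + Φ ε) := by
      intro ε
      have := hΦ0 ε
      rw [Real.mul_rpow (by norm_num) (by positivity), ← Real.rpow_mul (by positivity),
        one_div_mul_cancel hq0.ne', Real.rpow_one]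
    simp_rw [h1]
    rw [← Finset.mul_sum, Finset.sum_add_distrib, Finset.sum_const, Finset.card_univ,
      Fintype.card_fun, Fintype.card_bool, nsmul_eq_mul, mul_one, mul_comm (3 : ℝ), mul_assoc]
    refine mul_le_mul_of_nonneg_left ?_ (by positivity)
    push_cast
    linarith
  · show |X ε z| ≤ _ * (Real.sqrt (V z) * _)
    have hV0 : 0 ≤ V z := Finset.sum_nonneg fun i _ => sq_nonneg _
    have hE : 0 < h z + q := by linarith [h0 z]
    have hg0 : 0 < 1 + Φ ε := by linarith [hΦ0 ε]
    rcases hV0.eq_or_lt with hz | hz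
    · have hb : ∀ i, b z i = 0 := by
        intro i
        have := (Finset.sum_eq_zero_iff_of_nonneg (fun i _ => sq_nonneg (b z i))).1 hz.symm i
          (Finset.mem_univ i)
        simpa using this
      have hX0 : X ε z = 0 := by simp [hX, hb]
      rw [hX0, abs_zero, ← hz]
      simp
    · have hsV : s z ^ 2 * V z = h z + q := by
        simp only [hs, div_pow]
        rw [Real.sq_sqrt hE.le, Real.sq_sqrt hV0, div_mul_cancel₀ _ hz.ne']
      have hs0 : 0 ≤ s z := by positivity
      have hterm : Real.exp (-h z) * Real.exp (s z * |X ε z| - (h z + q) / 2) ≤ Φ ε := by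
        refine le_trans ?_ (Finset.single_le_sum (f := fun z => Real.exp (-h z) *
          (Real.exp (s z * X ε z - s z ^ 2 * V z / 2) +
          Real.exp (-s z * X ε z - (-s z) ^ 2 * V z / 2)))
          (fun z _ => by positivity) (Finset.mem_univ z))
        refine mul_le_mul_of_nonneg_left ?_ (Real.exp_pos _).le
        rw [neg_sq, hsV]
        rcases abs_cases (X ε z) with ⟨hx, -⟩ | ⟨hx, -⟩
        · rw [hx]
          linarith [Real.exp_pos (-s z * X ε z - (h z + q) / 2)]
        · rw [hx, mul_neg, ← neg_mul]
          linarith [Real.exp_pos (s z * X ε z - (h z + q) / 2)]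
      rw [← Real.exp_add] at hterm
      have hlog : s z * |X ε z| - (h z + q) / 2 - h z ≤ Real.log (1 + Φ ε) := by
        rw [Real.le_log_iff_exp_le hg0]
        refine le_trans (le_of_eq ?_) (hterm.trans (by linarith))
        congr 1
        ring
      set g := (1 + Φ ε) ^ (1 / q) with hg
      have hg1 : 1 ≤ g := Real.one_le_rpow (by linarith [hΦ0 ε]) (by positivity)
      -- The `q`-th root `g` costs only a factor `q` here: `log (1 + Φ) = q log g`. This term is
      -- then absorbed by the `q` in `h z + q`.
      have hlog2 : Real.log (1 + Φ ε) ≤ q * (g - 1) := by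
        have h1 : Real.log g = 1 / q * Real.log (1 + Φ ε) := Real.log_rpow hg0 _
        have h2 := Real.log_le_sub_one_of_pos (show 0 < g by linarith)
        rw [h1, one_div_mul_eq_div, div_le_iff₀ hq0] at h2
        linarith
      have hmain : s z * |X ε z| ≤ 2 * g * (h z + q) := by
        nlinarith [h0 z, mul_nonneg (h0 z) (sub_nonneg.2 hg1),
          mul_nonneg hq0.le (sub_nonneg.2 hg1)]
      have hsE : 0 < Real.sqrt (h z + q) := Real.sqrt_pos.2 hE
      have hsV' : 0 < Real.sqrt (V z) := Real.sqrt_pos.2 hz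
      simp only [hs] at hmain
      rw [div_mul_eq_mul_div, div_le_iff₀ hsV'] at hmain
      have hsq := Real.mul_self_sqrt hE.le
      refine le_of_mul_le_mul_left (hmain.trans (le_of_eq ?_)) hsE
      rw [← hsq]
      simp only [Real.sqrt_mul_self hsE.le]
      ring

/-! ### Multilinear forms and fibre norms -/

namespace RealTensor

/-- The multilinear form of a tensor, evaluated at vectors given by their coordinates. -/
noncomputable def form {d n : ℕ} (a : RealTensor d n) (y : Fin d → Fin n → ℝ) : ℝ :=
  ∑ i, a i * ∏ k, y k (i k)

/-- The largest Euclidean norm of a mode-`j` fibre. -/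
noncomputable def fibreNorm {d n : ℕ} (a : RealTensor d n) (j : Fin d) : ℝ :=
  ⨆ i : Fin d → Fin n, Real.sqrt (∑ t : Fin n, a (Function.update i j t) ^ 2)

theorem sqrt_sum_sq_le_fibreNorm {d n : ℕ} (a : RealTensor d n) (j : Fin d) (i : Fin d → Fin n) :
    Real.sqrt (∑ t : Fin n, a (Function.update i j t) ^ 2) ≤ a.fibreNorm j :=
  le_ciSup (f := fun i : Fin d → Fin n => Real.sqrt (∑ t : Fin n, a (Function.update i j t) ^ 2))
    (Set.finite_range _).bddAbove i

theorem fibreNorm_nonneg {d n : ℕ} (a : RealTensor d n) (j : Fin d) : 0 ≤ a.fibreNorm j :=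
  Real.iSup_nonneg fun _ => Real.sqrt_nonneg _

theorem sum_sq_le_fibreNorm_sq {d n : ℕ} (a : RealTensor d n) (j : Fin d) (i : Fin d → Fin n) :
    ∑ t : Fin n, a (Function.update i j t) ^ 2 ≤ a.fibreNorm j ^ 2 :=
  (Real.sqrt_le_left (a.fibreNorm_nonneg j)).1 (a.sqrt_sum_sq_le_fibreNorm j i)

/-- The weight does not involve the index in mode `j`. Summing over that index first leaves the
squared norm of one fibre, and the sum over the other indices factorizes. -/
theorem sum_sq_mul_prod_erase_le {d n : ℕ} (a : RealTensor d n) (j : Fin d)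
    (u : Fin d → Fin n → ℝ) (hu : ∀ k t, 0 ≤ u k t) :
    ∑ i, a i ^ 2 * ∏ k ∈ Finset.univ.erase j, u k (i k) ≤
      a.fibreNorm j ^ 2 * ∏ k ∈ Finset.univ.erase j, ∑ t, u k t := by
  have hsub : ∀ f : Fin d → ℝ, ∏ k ∈ Finset.univ.erase j, f k = ∏ k : {k // k ≠ j}, f k :=
    fun f => Finset.prod_subtype _ (by simp) f
  rw [← (Equiv.funSplitAt j (Fin n)).symm.sum_comp, Fintype.sum_prod_type_right, hsub,
    Fintype.prod_sum, Finset.mul_sum]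
  refine Finset.sum_le_sum fun r _ => ?_
  have h1 : ∀ t : Fin n, ∏ k ∈ Finset.univ.erase j,
      u k ((Equiv.funSplitAt j (Fin n)).symm (t, r) k) = ∏ k : {k // k ≠ j}, u k (r k) := by
    intro t
    rw [hsub]
    refine Finset.prod_congr rfl fun k _ => ?_
    simp [Equiv.funSplitAt, Equiv.piSplitAt, k.2]
  simp_rw [h1]
  rw [← Finset.sum_mul]
  refine mul_le_mul_of_nonneg_right ?_ (Finset.prod_nonneg fun k _ => hu _ _)
  rcases isEmpty_or_nonempty (Fin n) with hn | ⟨⟨t0⟩⟩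
  · simp [sq_nonneg]
  refine le_trans (le_of_eq (Finset.sum_congr rfl fun t _ => ?_))
    (a.sum_sq_le_fibreNorm_sq j ((Equiv.funSplitAt j (Fin n)).symm (t0, r)))
  congr 2
  funext k
  by_cases hk : k = j
  · subst hk
    simp [Equiv.funSplitAt, Equiv.piSplitAt]
  · simp [Equiv.funSplitAt, Equiv.piSplitAt, hk]

/-! ### Dyadic codes and their penalties -/

/-- Codes for the dyadic grid: `none` stands for `0` and `some (b, l)` for `± 2⁻ˡ`, `l ≤ n`. -/
abbrev DyadicCode (n : ℕ) : Type := Option (Bool × Fin (n + 1))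

/-- The real number denoted by a dyadic code. -/
noncomputable def dyadicVal {n : ℕ} : DyadicCode n → ℝ
  | none => 0
  | some v => boolSign v.1 * (1 / 2) ^ (v.2 : ℕ)

theorem boolSign_sq (b : Bool) : boolSign b ^ 2 = 1 := by cases b <;> simp [boolSign]

theorem dyadicVal_some_sq {n : ℕ} (v : Bool × Fin (n + 1)) :
    dyadicVal (some v) ^ 2 = (1 / 4) ^ (v.2 : ℕ) := by
  rw [dyadicVal, mul_pow, boolSign_sq, one_mul, ← pow_mul, mul_comm, pow_mul]
  norm_num

/-- The number of nonzero entries of a tuple of coded vectors. -/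
noncomputable def codeSupport {d n : ℕ} (z : Fin d → Fin n → DyadicCode n) : ℝ :=
  ∑ k, ∑ t, if (z k t).isSome then 1 else 0

theorem codeSupport_nonneg {d n : ℕ} (z : Fin d → Fin n → DyadicCode n) : 0 ≤ codeSupport z :=
  Finset.sum_nonneg fun _ _ => Finset.sum_nonneg fun _ _ => by split_ifs <;> norm_num

/-- The penalty of a tuple of coded vectors in the union bound. -/
noncomputable def codePenalty {d n : ℕ} (z : Fin d → Fin n → DyadicCode n) : ℝ :=
  3 * Real.log (n + 1) * codeSupport z + d

theorem log_succ_nonneg (n : ℕ) : 0 ≤ Real.log ((n : ℝ) + 1) :=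
  Real.log_nonneg (by linarith [(Nat.cast_nonneg n : (0 : ℝ) ≤ n)])

theorem codePenalty_nonneg {d n : ℕ} (z : Fin d → Fin n → DyadicCode n) : 0 ≤ codePenalty z := by
  have h1 := log_succ_nonneg n
  have h2 := codeSupport_nonneg z
  unfold codePenalty
  positivity

/-- The sum factorizes over modes and coordinates. The summand `d` of the penalty gives each mode a
factor `e⁻¹`, which absorbs the total coordinate weight `(1 + 2 / (n + 1)²)ⁿ ≤ e`. -/
theorem sum_exp_neg_codePenalty_le_one (d n : ℕ) :
    ∑ z : Fin d → Fin n → DyadicCode n, Real.exp (-codePenalty z) ≤ 1 := by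
  set ω : DyadicCode n → ℝ := fun c =>
    Real.exp (-(3 * Real.log (n + 1) * (if c.isSome then 1 else 0))) with hω
  have h1 : ∀ z : Fin d → Fin n → DyadicCode n, Real.exp (-codePenalty z) =
      ∏ k, (Real.exp (-1) * ∏ t, ω (z k t)) := by
    intro z
    simp only [hω]
    simp_rw [← Real.exp_sum, ← Real.exp_add]
    rw [← Real.exp_sum, Finset.sum_add_distrib]
    simp only [codePenalty, codeSupport, Finset.mul_sum, Finset.sum_neg_distrib, Finset.sum_const,
      Finset.card_univ, Fintype.card_fin, nsmul_eq_mul, mul_one, neg_add_rev]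
  have hn : (0 : ℝ) < (n : ℝ) + 1 := by positivity
  -- There are `2 (n + 1)` nonzero codes, each of weight `(n + 1)⁻³`.
  have hsum : ∑ c, ω c = 1 + 2 / ((n : ℝ) + 1) ^ 2 := by
    have : Real.exp (-(3 * Real.log ((n : ℝ) + 1))) = (((n : ℝ) + 1) ^ 3)⁻¹ := by
      rw [Real.exp_neg, show (3 : ℝ) * Real.log (n + 1) = ((3 : ℕ) : ℝ) * Real.log (n + 1) by simp,
        Real.exp_nat_mul, Real.exp_log hn]
    rw [Fintype.sum_option]
    simp only [hω, Option.isSome_none, Option.isSome_some, if_true, mul_one, this]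
    simp
    field_simp
  have hone : Real.exp (-1) * (∑ c, ω c) ^ n ≤ 1 := by
    have h2 : (∑ c, ω c) ^ n ≤ Real.exp 1 := by
      rw [hsum]
      calc (1 + 2 / ((n : ℝ) + 1) ^ 2) ^ n ≤ Real.exp (2 / ((n : ℝ) + 1) ^ 2) ^ n := by
            gcongr
            rw [add_comm]
            exact Real.add_one_le_exp _
        _ = Real.exp (n * (2 / ((n : ℝ) + 1) ^ 2)) := (Real.exp_nat_mul _ _).symm
        _ ≤ Real.exp 1 := by
            rw [Real.exp_le_exp, mul_div_assoc', div_le_one (by positivity)]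
            nlinarith [sq_nonneg ((n : ℝ))]
    calc _ ≤ Real.exp (-1) * Real.exp 1 := by gcongr
      _ = 1 := by rw [← Real.exp_add]; simp
  simp_rw [h1]
  rw [← Fintype.prod_sum (fun (_ : Fin d) (c : Fin n → DyadicCode n) =>
    Real.exp (-1) * ∏ t, ω (c t))]
  simp_rw [← Finset.mul_sum]
  rw [← Fintype.prod_sum (fun (_ : Fin n) (c : DyadicCode n) => ω c)]
  refine Finset.prod_le_one (fun _ _ => ?_) (fun _ _ => ?_)
  · positivity
  · simpa using hone

/-! ### Splitting a rank-one grid tensor by its maximal level -/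

/-- The levels kept in position `k` by the part `(j, l)` of the chaining decomposition: the
multi-indices whose maximal level is `l` and is attained first at position `j`. -/
def ChainKeep {d n : ℕ} (j : Fin d) (l : Fin (n + 1)) (k : Fin d) (m : Fin (n + 1)) : Prop :=
  (k < j → m < l) ∧ (k = j → m = l) ∧ (j < k → m ≤ l)

theorem ChainKeep.le {d n : ℕ} {j k : Fin d} {l m : Fin (n + 1)} (h : ChainKeep j l k m) :
    m ≤ l := by
  rcases lt_trichotomy k j with hk | hk | hk
  · exact (h.1 hk).le
  · exact (h.2.1 hk).le
  · exact h.2.2 hk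

theorem existsUnique_chainKeep {d n : ℕ} (hd : 1 ≤ d) (m : Fin d → Fin (n + 1)) :
    ∃ p : Fin d × Fin (n + 1), (∀ k, ChainKeep p.1 p.2 k (m k)) ∧
      ∀ p' : Fin d × Fin (n + 1), (∀ k, ChainKeep p'.1 p'.2 k (m k)) → p' = p := by
  have : Nonempty (Fin d) := ⟨⟨0, hd⟩⟩
  obtain ⟨k0, hk0⟩ := Finite.exists_max m
  obtain ⟨j, hj, hjmin⟩ := WellFounded.has_min (wellFounded_lt : WellFounded (α := Fin d) (· < ·))
    {k | m k = m k0} ⟨k0, rfl⟩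
  refine ⟨(j, m k0), fun k => ⟨fun hk => ?_, fun hk => ?_, fun _ => hk0 k⟩, ?_⟩
  · exact lt_of_le_of_ne (hk0 k) fun h => hjmin k h hk
  · rw [hk]; exact hj
  · rintro ⟨j', l'⟩ h
    have hl : l' = m k0 := by
      refine le_antisymm ?_ (h k0).le
      exact ((h j').2.1 rfl).symm.le.trans (hk0 j')
    subst hl
    have : j' = j := by
      rcases lt_trichotomy j j' with hlt | heq | hgt
      · exact absurd hj ((h j).1 hlt).ne
      · exact heq.symm
      · exact absurd hgt (hjmin j' ((h j').2.1 rfl))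
    rw [this]

open Classical in
/-- The part `(j, l)` of a tuple of coded vectors. -/
noncomputable def chainPart {d n : ℕ} (j : Fin d) (l : Fin (n + 1))
    (z : Fin d → Fin n → DyadicCode n) (k : Fin d) (t : Fin n) : DyadicCode n :=
  (z k t).filter fun v => decide (ChainKeep j l k v.2)

-- Masking the vectors separately selects multi-indices because each part is a product condition on
-- levels. Exactly one part keeps every factor of a nonzero product.
open Classical in
theorem prod_dyadicVal_eq_sum_chainPart {d n : ℕ} (hd : 1 ≤ d) (z : Fin d → Fin n → DyadicCode n)
    (i : Fin d → Fin n) :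
    ∏ k, dyadicVal (z k (i k)) =
      ∑ j, ∑ l, ∏ k, dyadicVal (chainPart j l z k (i k)) := by
  by_cases hz : ∃ k, z k (i k) = none
  · obtain ⟨k, hk⟩ := hz
    rw [Finset.prod_eq_zero (Finset.mem_univ k) (by rw [hk]; rfl)]
    symm
    refine Finset.sum_eq_zero fun j _ => Finset.sum_eq_zero fun l _ =>
      Finset.prod_eq_zero (Finset.mem_univ k) ?_
    rw [chainPart, hk]
    rfl
  · push Not at hz
    choose v hv using fun k => Option.ne_none_iff_exists'.1 (hz k)
    have hpart : ∀ j l, ∏ k, dyadicVal (chainPart j l z k (i k)) =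
        if ∀ k, ChainKeep j l k (v k).2 then ∏ k, dyadicVal (z k (i k)) else 0 := by
      intro j l
      have : ∀ k, dyadicVal (chainPart j l z k (i k)) =
          if ChainKeep j l k (v k).2 then dyadicVal (z k (i k)) else 0 := by
        intro k
        simp only [chainPart, hv, Option.filter_some, decide_eq_true_eq]
        split_ifs <;> rfl
      simp_rw [this]
      rw [Finset.prod_ite_zero]
      simp
    simp_rw [hpart]
    obtain ⟨p, hp, hpu⟩ := existsUnique_chainKeep hd fun k => (v k).2
    rw [← Fintype.sum_prod_type' (f := fun j l =>
      if ∀ k, ChainKeep j l k (v k).2 then ∏ k, dyadicVal (z k (i k)) else 0),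
      Finset.sum_eq_single p]
    · rw [if_pos hp]
    · intro p' _ hp'
      rw [if_neg fun h => hp' (hpu p' h)]
    · simp

theorem form_dyadicVal_eq_sum_chainPart {d n : ℕ} (hd : 1 ≤ d) (a : RealTensor d n)
    (z : Fin d → Fin n → DyadicCode n) :
    a.form (fun k t => dyadicVal (z k t)) =
      ∑ j, ∑ l, a.form (fun k t => dyadicVal (chainPart j l z k t)) := by
  simp only [form]
  simp_rw [prod_dyadicVal_eq_sum_chainPart hd z, Finset.mul_sum]
  rw [Finset.sum_comm]
  exact Finset.sum_congr rfl fun j _ => Finset.sum_comm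

/-! ### Variance and entropy of the parts -/

theorem dyadicVal_chainPart_sq_le {d n : ℕ} (j : Fin d) (l : Fin (n + 1))
    (z : Fin d → Fin n → DyadicCode n) (k : Fin d) (t : Fin n) :
    dyadicVal (chainPart j l z k t) ^ 2 ≤ dyadicVal (z k t) ^ 2 := by
  rw [chainPart]
  cases z k t with
  | none => simp
  | some v =>
    rw [Option.filter_some]
    split_ifs
    · exact le_rfl
    · simp [dyadicVal, sq_nonneg]

theorem dyadicVal_chainPart_self_sq_le {d n : ℕ} (j : Fin d) (l : Fin (n + 1))
    (z : Fin d → Fin n → DyadicCode n) (t : Fin n) :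
    4 ^ (l : ℕ) * dyadicVal (chainPart j l z j t) ^ 2 ≤
      if (z j t).map Prod.snd = some l then 1 else 0 := by
  rw [chainPart]
  cases z j t with
  | none => simp [dyadicVal]
  | some v =>
    rw [Option.filter_some]
    by_cases h : v.2 = l
    · have hk : ChainKeep j l j v.2 :=
        ⟨fun h => absurd h (lt_irrefl _), fun _ => h, fun h => absurd h (lt_irrefl _)⟩
      rw [if_pos (by simpa using hk), Option.map_some, h, if_pos rfl, dyadicVal_some_sq, h,
        ← mul_pow]
      norm_num
    · have hk : ¬ ChainKeep j l j v.2 := fun hk => h (hk.2.1 rfl)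
      simp [hk, h, dyadicVal]

/-- The weight `4ˡ` cancels the squared mode-`j` entry, and each entry has only one level. Hence the
sum over `l` just removes the factor of mode `j`. -/
theorem sum_variance_chainPart_le {d n : ℕ} (a : RealTensor d n) (j : Fin d)
    (z : Fin d → Fin n → DyadicCode n) :
    ∑ l : Fin (n + 1), 4 ^ (l : ℕ) *
        ∑ i, (a i * ∏ k, dyadicVal (chainPart j l z k (i k))) ^ 2 ≤
      a.fibreNorm j ^ 2 * ∏ k ∈ Finset.univ.erase j, ∑ t, dyadicVal (z k t) ^ 2 := by
  refine le_trans ?_ (sum_sq_mul_prod_erase_le a j (fun k t => dyadicVal (z k t) ^ 2)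
    fun _ _ => sq_nonneg _)
  simp_rw [Finset.mul_sum]
  rw [Finset.sum_comm]
  refine Finset.sum_le_sum fun i _ => ?_
  have h1 : ∀ l : Fin (n + 1), (4 : ℝ) ^ (l : ℕ) *
      (a i * ∏ k, dyadicVal (chainPart j l z k (i k))) ^ 2 ≤
      (if (z j (i j)).map Prod.snd = some l then 1 else 0) *
        (a i ^ 2 * ∏ k ∈ Finset.univ.erase j, dyadicVal (z k (i k)) ^ 2) := by
    intro l
    rw [mul_pow, ← Finset.prod_pow, ← Finset.mul_prod_erase _ _ (Finset.mem_univ j)]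
    calc _ = (4 ^ (l : ℕ) * dyadicVal (chainPart j l z j (i j)) ^ 2) * (a i ^ 2 *
          ∏ k ∈ Finset.univ.erase j, dyadicVal (chainPart j l z k (i k)) ^ 2) := by ring
      _ ≤ _ := by
          refine mul_le_mul (dyadicVal_chainPart_self_sq_le j l z (i j)) ?_
            (mul_nonneg (sq_nonneg _) (Finset.prod_nonneg fun _ _ => sq_nonneg _))
            (by split_ifs <;> norm_num)
          exact mul_le_mul_of_nonneg_left (Finset.prod_le_prod (fun _ _ => sq_nonneg _)
            fun k _ => dyadicVal_chainPart_sq_le j l z k (i k)) (sq_nonneg _)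
  refine (Finset.sum_le_sum fun l _ => h1 l).trans ?_
  rw [← Finset.sum_mul]
  refine mul_le_of_le_one_left
    (mul_nonneg (sq_nonneg _) (Finset.prod_nonneg fun _ _ => sq_nonneg _)) ?_
  cases z j (i j) with
  | none => simp
  | some v => simp

theorem sum_quarter_pow_tail (N m : ℕ) :
    ∑ l ∈ Finset.range N, (if m ≤ l then (1 / 4 : ℝ) ^ l else 0) + 4 / 3 * (1 / 4) ^ max m N =
      4 / 3 * (1 / 4) ^ m := by
  induction N with
  | zero => simp
  | succ N ih =>
    rw [Finset.sum_range_succ]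
    by_cases h : m ≤ N
    · rw [if_pos h, max_eq_right (by omega)]
      rw [max_eq_right h] at ih
      rw [← ih, pow_succ]
      ring
    · rw [if_neg h, max_eq_left (by omega)]
      rw [max_eq_left (by omega)] at ih
      linarith

theorem sum_fin_quarter_pow_tail_le (N m : ℕ) :
    ∑ l : Fin N, (if m ≤ (l : ℕ) then (1 / 4 : ℝ) ^ (l : ℕ) else 0) ≤ 4 / 3 * (1 / 4) ^ m := by
  rw [Fin.sum_univ_eq_sum_range (fun l : ℕ => if m ≤ l then (1 / 4 : ℝ) ^ l else 0),
    ← sum_quarter_pow_tail N m]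
  have : (0 : ℝ) ≤ 4 / 3 * (1 / 4) ^ max m N := by positivity
  linarith

/-- An entry of level `m` survives only in parts with `l ≥ m`, so it contributes at most a geometric
tail `4/3 · 4⁻ᵐ`, that is `4/3` times its square. -/
theorem sum_quarter_pow_mul_codeSupport_chainPart_le {d n : ℕ} (j : Fin d)
    (z : Fin d → Fin n → DyadicCode n) :
    ∑ l : Fin (n + 1), (1 / 4 : ℝ) ^ (l : ℕ) * codeSupport (chainPart j l z) ≤
      4 / 3 * ∑ k, ∑ t, dyadicVal (z k t) ^ 2 := by
  simp only [codeSupport, Finset.mul_sum]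
  rw [Finset.sum_comm]
  refine Finset.sum_le_sum fun k _ => ?_
  rw [Finset.sum_comm]
  refine Finset.sum_le_sum fun t _ => ?_
  simp only [chainPart]
  obtain hc | ⟨v, hc⟩ := Option.eq_none_or_eq_some (z k t)
  · simp [hc, dyadicVal]
  · simp only [hc, dyadicVal_some_sq]
    refine le_trans (Finset.sum_le_sum fun l _ => ?_) (sum_fin_quarter_pow_tail_le (n + 1) v.2)
    rw [Option.filter_some]
    by_cases h : ChainKeep j l k v.2
    · have := h.le
      simp [h, Fin.le_def.1 this]
    · simp only [h, decide_false]
      simp only [Bool.false_eq_true, if_false, Option.isSome_none, mul_zero]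
      positivity

/-- The entropy term of the chaining bound. -/
noncomputable def chainEntropy (d n : ℕ) (q : ℝ) : ℝ :=
  20 * d * Real.log (n + 1) + 4 / 3 * (d + q)

theorem sum_quarter_pow_mul_penalty_le {d n : ℕ} {q : ℝ} (hq : 0 ≤ q) (j : Fin d)
    (z : Fin d → Fin n → DyadicCode n) (hz : ∀ k, ∑ t, dyadicVal (z k t) ^ 2 ≤ 5) :
    ∑ l : Fin (n + 1), (1 / 4 : ℝ) ^ (l : ℕ) * (codePenalty (chainPart j l z) + q) ≤
      chainEntropy d n q := by
  have h1 := sum_quarter_pow_mul_codeSupport_chainPart_le j z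
  have h2 : ∑ k, ∑ t, dyadicVal (z k t) ^ 2 ≤ d * 5 := by
    refine (Finset.sum_le_sum fun k _ => hz k).trans ?_
    simp
  have h3 := sum_fin_quarter_pow_tail_le (n + 1) 0
  simp only [Nat.zero_le, if_true, pow_zero, mul_one] at h3
  have h4 := log_succ_nonneg n
  have h5 : ∑ l : Fin (n + 1), (1 / 4 : ℝ) ^ (l : ℕ) * (codePenalty (chainPart j l z) + q) =
      3 * Real.log (n + 1) * ∑ l : Fin (n + 1), (1 / 4 : ℝ) ^ (l : ℕ) *
        codeSupport (chainPart j l z) + (d + q) * ∑ l : Fin (n + 1), (1 / 4 : ℝ) ^ (l : ℕ) := by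
    rw [Finset.mul_sum, Finset.mul_sum, ← Finset.sum_add_distrib]
    refine Finset.sum_congr rfl fun l _ => ?_
    rw [codePenalty]
    ring
  rw [h5, chainEntropy]
  have h6 : 3 * Real.log (n + 1) * ∑ l : Fin (n + 1), (1 / 4 : ℝ) ^ (l : ℕ) *
        codeSupport (chainPart j l z) ≤ 3 * Real.log (n + 1) * (4 / 3 * (d * 5)) := by
    gcongr
    linarith
  have h7 : ((d : ℝ) + q) * ∑ l : Fin (n + 1), (1 / 4 : ℝ) ^ (l : ℕ) ≤ (d + q) * (4 / 3) := by
    gcongr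
  linarith

theorem sum_sqrt_chainPart_le {d n : ℕ} (a : RealTensor d n) {q : ℝ} (hq : 0 ≤ q) (j : Fin d)
    (z : Fin d → Fin n → DyadicCode n) (hz : ∀ k, ∑ t, dyadicVal (z k t) ^ 2 ≤ 5) :
    ∑ l, Real.sqrt (∑ i, (a i * ∏ k, dyadicVal (chainPart j l z k (i k))) ^ 2) *
        Real.sqrt (codePenalty (chainPart j l z) + q) ≤
      a.fibreNorm j * Real.sqrt (5 ^ (d - 1)) * Real.sqrt (chainEntropy d n q) := by
  -- Inserting `2ˡ · 2⁻ˡ` before Cauchy–Schwarz makes both sums over `l` bounded independently of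
  -- the number of levels.
  have h1 : ∀ l : Fin (n + 1),
      Real.sqrt (∑ i, (a i * ∏ k, dyadicVal (chainPart j l z k (i k))) ^ 2) *
        Real.sqrt (codePenalty (chainPart j l z) + q) =
      Real.sqrt (4 ^ (l : ℕ) * ∑ i, (a i * ∏ k, dyadicVal (chainPart j l z k (i k))) ^ 2) *
        Real.sqrt ((1 / 4) ^ (l : ℕ) * (codePenalty (chainPart j l z) + q)) := by
    intro l
    rw [Real.sqrt_mul (by positivity), Real.sqrt_mul (by positivity)]
    have : Real.sqrt (4 ^ (l : ℕ)) * Real.sqrt ((1 / 4) ^ (l : ℕ)) = 1 := by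
      rw [← Real.sqrt_mul (by positivity), ← mul_pow]
      norm_num
    calc _ = (Real.sqrt (4 ^ (l : ℕ)) * Real.sqrt ((1 / 4) ^ (l : ℕ))) *
          (Real.sqrt (∑ i, (a i * ∏ k, dyadicVal (chainPart j l z k (i k))) ^ 2) *
            Real.sqrt (codePenalty (chainPart j l z) + q)) := by rw [this, one_mul]
      _ = _ := by ring
  simp_rw [h1]
  refine (Real.sum_sqrt_mul_sqrt_le _ (fun l => ?_) fun l => ?_).trans ?_
  · positivity
  · have := codePenalty_nonneg (chainPart j l z)
    positivity
  refine mul_le_mul ?_ (Real.sqrt_le_sqrt (sum_quarter_pow_mul_penalty_le hq j z hz))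
    (Real.sqrt_nonneg _) (mul_nonneg (a.fibreNorm_nonneg j) (Real.sqrt_nonneg _))
  nth_rewrite 1 [← Real.sqrt_sq (a.fibreNorm_nonneg j)]
  rw [← Real.sqrt_mul (sq_nonneg _)]
  refine Real.sqrt_le_sqrt ((sum_variance_chainPart_le a j z).trans ?_)
  refine mul_le_mul_of_nonneg_left ?_ (sq_nonneg _)
  refine (Finset.prod_le_prod (fun k _ => Finset.sum_nonneg fun _ _ => sq_nonneg _)
    fun k _ => hz k).trans ?_
  simp

/-! ### Rounding unit vectors to the dyadic grid -/

theorem exists_form_update_eq_affine {d n : ℕ} (a : RealTensor d n) (y : Fin d × Fin n → ℝ)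
    (p : Fin d × Fin n) :
    ∃ α β : ℝ, ∀ s, a.form (fun k t => Function.update y p s (k, t)) = α + β * s := by
  have h : ∀ i : Fin d → Fin n, ∃ α β : ℝ, ∀ s,
      a i * ∏ k, Function.update y p s (k, i k) = α + β * s := by
    intro i
    by_cases hi : i p.1 = p.2
    · refine ⟨0, a i * ∏ k ∈ Finset.univ.erase p.1, y (k, i k), fun s => ?_⟩
      rw [← Finset.mul_prod_erase _ _ (Finset.mem_univ p.1)]
      have h1 : Function.update y p s (p.1, i p.1) = s := by rw [hi]; simp
      have h2 : ∏ k ∈ Finset.univ.erase p.1, Function.update y p s (k, i k) =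
          ∏ k ∈ Finset.univ.erase p.1, y (k, i k) := by
        refine Finset.prod_congr rfl fun k hk => Function.update_of_ne ?_ _ _
        exact fun h => (Finset.mem_erase.1 hk).1 (congrArg Prod.fst h)
      rw [h1, h2]
      ring
    · refine ⟨a i * ∏ k, y (k, i k), 0, fun s => ?_⟩
      rw [zero_mul, add_zero]
      congr 1
      refine Finset.prod_congr rfl fun k _ => Function.update_of_ne ?_ _ _
      rintro rfl
      exact hi rfl
  choose α β hαβ using h
  refine ⟨∑ i, α i, ∑ i, β i, fun s => ?_⟩
  simp only [form, hαβ]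
  rw [Finset.sum_add_distrib, Finset.sum_mul]

theorem abs_affine_le_max {α β lo hi s : ℝ} (h1 : lo ≤ s) (h2 : s ≤ hi) :
    |α + β * s| ≤ max |α + β * lo| |α + β * hi| := by
  rcases le_total 0 β with hβ | hβ
  · exact abs_le_max_abs_abs (by gcongr) (by gcongr)
  · rw [max_comm]
    exact abs_le_max_abs_abs (by nlinarith) (by nlinarith)

/-- The absolute value of an affine function on an interval is largest at an endpoint; the
coordinates in `S` are moved one at a time. -/
theorem exists_vertex_abs_form_le {d n : ℕ} (a : RealTensor d n)
    (y lo hi : Fin d × Fin n → ℝ) (hlo : ∀ p, lo p ≤ y p) (hhi : ∀ p, y p ≤ hi p)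
    (S : Finset (Fin d × Fin n)) :
    ∃ v : Fin d × Fin n → ℝ, (∀ p ∈ S, v p = lo p ∨ v p = hi p) ∧ (∀ p ∉ S, v p = y p) ∧
      |a.form (fun k t => y (k, t))| ≤ |a.form (fun k t => v (k, t))| := by
  induction S using Finset.induction_on with
  | empty => exact ⟨y, by simp, by simp, le_rfl⟩
  | insert p S hp ih =>
    obtain ⟨v, hv1, hv2, hv3⟩ := ih
    obtain ⟨α, β, hαβ⟩ := exists_form_update_eq_affine a v p
    have hcases : ∃ s, (s = lo p ∨ s = hi p) ∧ |α + β * v p| ≤ |α + β * s| := by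
      rcases le_max_iff.1 (abs_affine_le_max (α := α) (β := β) ((hlo p).trans_eq (hv2 p hp).symm)
        ((hv2 p hp).trans_le (hhi p))) with h | h
      · exact ⟨_, Or.inl rfl, h⟩
      · exact ⟨_, Or.inr rfl, h⟩
    obtain ⟨s, hs, hle⟩ := hcases
    refine ⟨Function.update v p s, ?_, ?_, ?_⟩
    · intro p' hp'
      by_cases h : p' = p
      · subst h
        simpa using hs
      · rw [Function.update_of_ne h]
        exact hv1 p' ((Finset.mem_insert.1 hp').resolve_left h)
    · intro p' hp'
      rw [Finset.mem_insert, not_or] at hp'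
      rw [Function.update_of_ne hp'.1]
      exact hv2 p' hp'.2
    · have h := hαβ (v p)
      rw [Function.update_eq_self] at h
      rw [hαβ s]
      exact hv3.trans (h ▸ hle)

theorem exists_dyadic_bracket_of_nonneg {n : ℕ} {x : ℝ} (h0 : 0 ≤ x) (h1 : x ≤ 1) :
    ∃ u v : DyadicCode n, dyadicVal u ≤ x ∧ x ≤ dyadicVal v ∧
      dyadicVal u ^ 2 ≤ 4 * x ^ 2 + (1 / 4) ^ n ∧ dyadicVal v ^ 2 ≤ 4 * x ^ 2 + (1 / 4) ^ n := by
  have hpos : (0 : ℝ) ≤ (1 / 4) ^ n := by positivity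
  have hx2 := sq_nonneg x
  rcases h0.eq_or_lt with rfl | hx
  · exact ⟨none, none, by simp [dyadicVal]⟩
  obtain ⟨m, hm1, hm2⟩ := exists_nat_pow_near_of_lt_one hx h1 (show (0 : ℝ) < 1 / 2 by norm_num)
    (by norm_num)
  have hval : ∀ l : Fin (n + 1), dyadicVal (some (true, l)) = (1 / 2 : ℝ) ^ (l : ℕ) := by
    intro l
    simp [dyadicVal, boolSign]
  by_cases hmn : m + 1 ≤ n
  · refine ⟨some (true, ⟨m + 1, by omega⟩), some (true, ⟨m, by omega⟩), ?_⟩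
    rw [hval, hval]
    simp only
    have hp : (0 : ℝ) < (1 / 2) ^ m := by positivity
    rw [pow_succ] at hm1 ⊢
    refine ⟨hm1.le, hm2, ?_, ?_⟩ <;> nlinarith
  -- Here `x ≤ 2⁻ⁿ` lies below the finest level, which is why the bounds carry the additive `4⁻ⁿ`.
  · refine ⟨none, some (true, ⟨n, by omega⟩), ?_, ?_, ?_, ?_⟩
    · exact h0
    · rw [hval]
      exact hm2.trans (pow_le_pow_of_le_one (by norm_num) (by norm_num) (by omega))
    · simp only [dyadicVal]
      linarith
    · rw [dyadicVal_some_sq]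
      simp only
      linarith

theorem exists_dyadic_bracket {n : ℕ} {x : ℝ} (hx : |x| ≤ 1) :
    ∃ u v : DyadicCode n, dyadicVal u ≤ x ∧ x ≤ dyadicVal v ∧
      dyadicVal u ^ 2 ≤ 4 * x ^ 2 + (1 / 4) ^ n ∧ dyadicVal v ^ 2 ≤ 4 * x ^ 2 + (1 / 4) ^ n := by
  rcases le_total 0 x with h | h
  · exact exists_dyadic_bracket_of_nonneg h ((le_abs_self x).trans hx)
  · obtain ⟨u, v, h1, h2, h3, h4⟩ := exists_dyadic_bracket_of_nonneg (n := n) (neg_nonneg.2 h)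
      ((neg_le_abs x).trans hx)
    have hneg : ∀ c : DyadicCode n, ∃ c' : DyadicCode n, dyadicVal c' = -dyadicVal c := by
      rintro (_ | ⟨b, l⟩)
      · exact ⟨none, by simp [dyadicVal]⟩
      · exact ⟨some (!b, l), by cases b <;> simp [dyadicVal, boolSign]⟩
    obtain ⟨u', hu'⟩ := hneg u
    obtain ⟨v', hv'⟩ := hneg v
    rw [neg_sq] at h3 h4
    exact ⟨v', u', by linarith, by linarith, by rw [hv', neg_sq]; exact h4,
      by rw [hu', neg_sq]; exact h3⟩

/-- Tuples of coded vectors whose Euclidean norms are at most `√5`. -/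
abbrev BoundedCode (d n : ℕ) : Type :=
  {z : Fin d → Fin n → DyadicCode n // ∀ k, ∑ t, dyadicVal (z k t) ^ 2 ≤ 5}

instance (d n : ℕ) : Nonempty (BoundedCode d n) := ⟨⟨fun _ _ => none, by simp [dyadicVal]⟩⟩

/-- The maximum of the multilinear form over bounded dyadic vectors. -/
noncomputable def gridNorm {d n : ℕ} (a : RealTensor d n) : ℝ :=
  ⨆ z : BoundedCode d n, |a.form fun k t => dyadicVal (z.1 k t)|

theorem gridNorm_nonneg {d n : ℕ} (a : RealTensor d n) : 0 ≤ a.gridNorm :=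
  Real.iSup_nonneg fun _ => abs_nonneg _

theorem abs_form_le_gridNorm {d n : ℕ} (a : RealTensor d n) (z : BoundedCode d n) :
    |a.form fun k t => dyadicVal (z.1 k t)| ≤ a.gridNorm :=
  le_ciSup (f := fun z : BoundedCode d n => |a.form fun k t => dyadicVal (z.1 k t)|)
    (Set.finite_range _).bddAbove z

/-- Moving to a vertex of the bracketing box does not decrease the form, so there is no
multiplicative loss. The bound `5` arises as `4 · 1 + n · 4⁻ⁿ ≤ 5`. -/
theorem spectralNorm_le_gridNorm {d n : ℕ} (a : RealTensor d n) :
    a.spectralNorm ≤ a.gridNorm := by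
  refine Real.sSup_le ?_ a.gridNorm_nonneg
  rintro r ⟨x, hx, rfl⟩
  have hx1 : ∀ p : Fin d × Fin n, |x p.1 p.2| ≤ 1 := by
    intro p
    have h := PiLp.norm_apply_le (x p.1) p.2
    rwa [hx p.1, Real.norm_eq_abs] at h
  choose u w hu hw hu2 hw2 using fun p => exists_dyadic_bracket (n := n) (hx1 p)
  obtain ⟨v, hv, -, hle⟩ := exists_vertex_abs_form_le a (fun p => x p.1 p.2)
    (fun p => dyadicVal (u p)) (fun p => dyadicVal (w p)) hu hw Finset.univ
  have hz : ∀ p, ∃ c : DyadicCode n, v p = dyadicVal c ∧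
      dyadicVal c ^ 2 ≤ 4 * x p.1 p.2 ^ 2 + (1 / 4) ^ n := by
    intro p
    rcases hv p (Finset.mem_univ p) with h | h
    · exact ⟨u p, h, hu2 p⟩
    · exact ⟨w p, h, hw2 p⟩
  choose c hc hc2 using hz
  have hnorm : ∀ k, ∑ t, dyadicVal (c (k, t)) ^ 2 ≤ 5 := by
    intro k
    have h1 : ∑ t, x k t ^ 2 = 1 := by
      rw [← EuclideanSpace.real_norm_sq_eq, hx k, one_pow]
    have h2 : (n : ℝ) * (1 / 4) ^ n ≤ 1 := by
      rw [one_div, inv_pow, ← div_eq_mul_inv, div_le_one (by positivity)]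
      exact_mod_cast (Nat.lt_pow_self (by norm_num : 1 < 4)).le
    refine (Finset.sum_le_sum fun t _ => hc2 (k, t)).trans ?_
    rw [Finset.sum_add_distrib, ← Finset.mul_sum, h1, Finset.sum_const, Finset.card_univ,
      Fintype.card_fin, nsmul_eq_mul]
    linarith
  refine hle.trans ?_
  simp only [hc]
  exact abs_form_le_gridNorm a ⟨fun k t => c (k, t), hnorm⟩

/-! ### The chaining bound for random signs -/

theorem sum_gridNorm_boolSign_rpow_le {d n : ℕ} (hd : 1 ≤ d) (a : RealTensor d n) {q : ℝ}
    (hq : 1 ≤ q) :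
    ∑ ε : (Fin d → Fin n) → Bool, gridNorm (fun i => boolSign (ε i) * a i) ^ q ≤
      3 * 2 ^ q * 2 ^ Fintype.card (Fin d → Fin n) *
        (Real.sqrt (5 ^ (d - 1)) * Real.sqrt (chainEntropy d n q) * ∑ j, a.fibreNorm j) ^ q := by
  obtain ⟨G, hG0, hGsum, hG⟩ := exists_uniform_bound_rademacher
    (fun (z : Fin d → Fin n → DyadicCode n) (i : Fin d → Fin n) => a i * ∏ k, dyadicVal (z k (i k)))
    codePenalty codePenalty_nonneg (sum_exp_neg_codePenalty_le_one d n) hq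
  set K := Real.sqrt (5 ^ (d - 1)) * Real.sqrt (chainEntropy d n q) * ∑ j, a.fibreNorm j with hK
  have hK0 : 0 ≤ K :=
    mul_nonneg (by positivity) (Finset.sum_nonneg fun j _ => a.fibreNorm_nonneg j)
  have hbound : ∀ ε : (Fin d → Fin n) → Bool,
      gridNorm (fun i => boolSign (ε i) * a i) ≤ G ε * K := by
    intro ε
    refine ciSup_le fun z => ?_
    have hform : ∀ z : Fin d → Fin n → DyadicCode n,
        form (fun i => boolSign (ε i) * a i) (fun k t => dyadicVal (z k t)) =
          ∑ i, boolSign (ε i) * (a i * ∏ k, dyadicVal (z k (i k))) :=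
      fun z => Finset.sum_congr rfl fun i _ => mul_assoc _ _ _
    rw [form_dyadicVal_eq_sum_chainPart hd]
    refine (Finset.abs_sum_le_sum_abs _ _).trans ?_
    rw [hK, Finset.mul_sum, Finset.mul_sum]
    refine Finset.sum_le_sum fun j _ => (Finset.abs_sum_le_sum_abs _ _).trans ?_
    calc _ ≤ ∑ l, G ε * (Real.sqrt (∑ i, (a i * ∏ k, dyadicVal (chainPart j l z.1 k (i k))) ^ 2) *
          Real.sqrt (codePenalty (chainPart j l z.1) + q)) := by
          refine Finset.sum_le_sum fun l _ => ?_
          rw [hform]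
          -- Every part is again a tuple of codes, so the same factor `G ε` serves all `j` and `l`.
          exact hG ε _
      _ ≤ G ε * (a.fibreNorm j * Real.sqrt (5 ^ (d - 1)) * Real.sqrt (chainEntropy d n q)) := by
          rw [← Finset.mul_sum]
          exact mul_le_mul_of_nonneg_left
            (sum_sqrt_chainPart_le a (by linarith) j z.1 z.2) (hG0 ε)
      _ = _ := by ring
  calc _ ≤ ∑ ε, G ε ^ q * K ^ q := by
        refine Finset.sum_le_sum fun ε _ => ?_
        rw [← Real.mul_rpow (hG0 ε) hK0]
        exact Real.rpow_le_rpow (gridNorm_nonneg _) (hbound ε) (by linarith)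
    _ ≤ _ := by
        rw [← Finset.sum_mul]
        exact mul_le_mul_of_nonneg_right hGsum (Real.rpow_nonneg hK0 _)

/-! ### Fibre moments and numerical constants -/

theorem sqrt_sum_sub_sq_le {ι : Type*} [Fintype ι] (x y : ι → ℝ) :
    Real.sqrt (∑ t, (x t - y t) ^ 2) ≤ Real.sqrt (∑ t, x t ^ 2) + Real.sqrt (∑ t, y t ^ 2) := by
  have h := norm_sub_le (WithLp.toLp 2 x : EuclideanSpace ℝ ι) (WithLp.toLp 2 y)
  simpa [EuclideanSpace.norm_eq] using h

theorem fibreNorm_sub_le {d n : ℕ} (a b : RealTensor d n) (j : Fin d) :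
    fibreNorm (a - b) j ≤ a.fibreNorm j + b.fibreNorm j := by
  refine Real.iSup_le (fun i => ?_) (add_nonneg (a.fibreNorm_nonneg j) (b.fibreNorm_nonneg j))
  exact (sqrt_sum_sub_sq_le _ _).trans
    (add_le_add (a.sqrt_sum_sq_le_fibreNorm j i) (b.sqrt_sum_sq_le_fibreNorm j i))

theorem maxFibre_nonneg {d n : ℕ} (a : RealTensor d n) (q : ℝ) (j : Fin d) :
    0 ≤ a.maxFibre q j :=
  Real.iSup_nonneg fun _ => Real.rpow_nonneg (Finset.sum_nonneg fun _ _ => sq_nonneg _) _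

theorem fibreNorm_rpow_le_maxFibre {d n : ℕ} (hn : 1 ≤ n) (a : RealTensor d n) (q : ℝ)
    (j : Fin d) : a.fibreNorm j ^ q ≤ a.maxFibre q j := by
  have : Nonempty (Fin d → Fin n) := ⟨fun _ => ⟨0, hn⟩⟩
  obtain ⟨i, hi⟩ := exists_eq_ciSup_of_finite
    (f := fun i : Fin d → Fin n => Real.sqrt (∑ t : Fin n, a (Function.update i j t) ^ 2))
  rw [fibreNorm, ← hi, Real.sqrt_eq_rpow, ← Real.rpow_mul
    (Finset.sum_nonneg fun _ _ => sq_nonneg _), one_div_mul_eq_div]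
  exact le_ciSup (f := fun i : Fin d → Fin n =>
    (∑ t : Fin n, a (Function.update i j t) ^ 2) ^ (q / 2)) (Set.finite_range _).bddAbove i

theorem sum_fibreNorm_sub_rpow_le {d n : ℕ} (hd : 1 ≤ d) (hn : 1 ≤ n) (a b : RealTensor d n)
    {q : ℝ} (hq : 1 ≤ q) :
    (∑ j, fibreNorm (a - b) j) ^ q ≤
      (2 * d) ^ q * ((∑ j, a.maxFibre q j) + ∑ j, b.maxFibre q j) := by
  have hd' : (1 : ℝ) ≤ d := by exact_mod_cast hd
  set f : Fin d ⊕ Fin d → ℝ := Sum.elim (fun j => a.fibreNorm j) fun j => b.fibreNorm j with hf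
  have hf0 : ∀ s, 0 ≤ f s := by
    rintro (j | j)
    · exact a.fibreNorm_nonneg j
    · exact b.fibreNorm_nonneg j
  have hH0 : 0 ≤ (∑ j, a.maxFibre q j) + ∑ j, b.maxFibre q j :=
    add_nonneg (Finset.sum_nonneg fun j _ => a.maxFibre_nonneg q j)
      (Finset.sum_nonneg fun j _ => b.maxFibre_nonneg q j)
  calc (∑ j, fibreNorm (a - b) j) ^ q ≤ (∑ s, |f s|) ^ q := by
        refine Real.rpow_le_rpow (Finset.sum_nonneg fun j _ => fibreNorm_nonneg _ j) ?_
          (by linarith)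
        simp_rw [abs_of_nonneg (hf0 _)]
        rw [Fintype.sum_sum_type, ← Finset.sum_add_distrib]
        exact Finset.sum_le_sum fun j _ => fibreNorm_sub_le a b j
    -- Power mean inequality for the `2 d` fibre norms of `a` and `b`.
    _ ≤ (2 * d) ^ (q - 1) * ∑ s, |f s| ^ q := by
        have h := Real.rpow_sum_le_const_mul_sum_rpow Finset.univ f hq
        rw [Finset.card_univ, Fintype.card_sum, Fintype.card_fin] at h
        push_cast at h
        rwa [← two_mul] at h
    _ ≤ (2 * d) ^ q * ((∑ j, a.maxFibre q j) + ∑ j, b.maxFibre q j) := by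
        refine mul_le_mul (Real.rpow_le_rpow_of_exponent_le (by linarith) (by linarith)) ?_
          (Finset.sum_nonneg fun _ _ => Real.rpow_nonneg (abs_nonneg _) _) (by positivity)
        simp_rw [abs_of_nonneg (hf0 _)]
        rw [Fintype.sum_sum_type]
        exact add_le_add (Finset.sum_le_sum fun j _ => fibreNorm_rpow_le_maxFibre hn a q j)
          (Finset.sum_le_sum fun j _ => fibreNorm_rpow_le_maxFibre hn b q j)

/-- For `n = 1` the term `d log n` vanishes, so the summands of order `d` must be absorbed by `d q`.
This costs the extra factor `√d`. -/
theorem chainEntropy_le {d n : ℕ} (hd : 1 ≤ d) (hn : 1 ≤ n) {q : ℝ} (hq : 1 ≤ q) :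
    chainEntropy d n q ≤ (5 * Real.sqrt d * (Real.sqrt (d * Real.log n) + Real.sqrt q)) ^ 2 := by
  have hd' : (1 : ℝ) ≤ d := by exact_mod_cast hd
  have hn' : (1 : ℝ) ≤ n := by exact_mod_cast hn
  have hL0 : 0 ≤ Real.log n := Real.log_nonneg hn'
  have hL : Real.log (n + 1) ≤ Real.log n + 1 := by
    calc Real.log (n + 1) ≤ Real.log (n * 2) :=
          Real.log_le_log (by linarith) (by linarith)
      _ = Real.log n + Real.log 2 := Real.log_mul (by linarith) (by norm_num)
      _ ≤ _ := by linarith [Real.log_le_sub_one_of_pos (show (0 : ℝ) < 2 by norm_num)]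
  have h1 : d * Real.log n + q ≤ (Real.sqrt (d * Real.log n) + Real.sqrt q) ^ 2 := by
    have h2 := Real.sq_sqrt (show 0 ≤ d * Real.log n by positivity)
    have h3 := Real.sq_sqrt (show 0 ≤ q by linarith)
    nlinarith [mul_nonneg (Real.sqrt_nonneg (d * Real.log n)) (Real.sqrt_nonneg q)]
  have h4 : chainEntropy d n q ≤ 25 * d * (d * Real.log n + q) := by
    have h5 : (d : ℝ) * Real.log (n + 1) ≤ d * (Real.log n + 1) := by gcongr
    have h6 : (d : ℝ) ≤ d * q := le_mul_of_one_le_right (by linarith) hq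
    have h7 : q ≤ d * q := le_mul_of_one_le_left (by linarith) hd'
    have h8 : (d : ℝ) * Real.log n ≤ d * (d * Real.log n) := by
      gcongr
      exact le_mul_of_one_le_left hL0 hd'
    have h9 : 0 ≤ (d : ℝ) * Real.log n := by positivity
    unfold chainEntropy
    nlinarith
  calc _ ≤ 25 * d * (d * Real.log n + q) := h4
    _ ≤ 25 * d * (Real.sqrt (d * Real.log n) + Real.sqrt q) ^ 2 := by gcongr
    _ = _ := by
        rw [mul_pow, mul_pow, Real.sq_sqrt (by linarith)]
        norm_num

theorem mul_sqrt_chainEntropy_le {d n : ℕ} (hd : 1 ≤ d) (hn : 1 ≤ n) {q : ℝ} (hq : 1 ≤ q) :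
    24 * d * (Real.sqrt (5 ^ (d - 1)) * Real.sqrt (chainEntropy d n q)) ≤
      120 * 2 ^ (3 * (d - 1)) * (Real.sqrt (d * Real.log n) + Real.sqrt q) := by
  set R := Real.sqrt (d * Real.log n) + Real.sqrt q with hR
  have hR0 : 0 ≤ R := by positivity
  have h1 : Real.sqrt (chainEntropy d n q) ≤ 5 * Real.sqrt d * R := by
    rw [Real.sqrt_le_left (by positivity)]
    exact chainEntropy_le hd hn hq
  have h2 : (d : ℝ) ≤ 2 ^ (d - 1) := by
    have h := (d - 1).lt_two_pow_self
    have h' : d ≤ 2 ^ (d - 1) := by omega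
    exact_mod_cast h'
  -- After squaring, this follows from `5 ≤ 8` and `d ≤ 2 ^ (d - 1)`, since `8 · 2³ = 2⁶`.
  have h3 : d * (Real.sqrt (5 ^ (d - 1)) * Real.sqrt d) ≤ (2 : ℝ) ^ (3 * (d - 1)) := by
    rw [← Real.sqrt_mul (by positivity)]
    calc (d : ℝ) * Real.sqrt (5 ^ (d - 1) * d) = Real.sqrt (d ^ 2 * (5 ^ (d - 1) * d)) := by
          rw [Real.sqrt_mul (sq_nonneg _), Real.sqrt_sq (by positivity)]
      _ ≤ Real.sqrt ((2 ^ (3 * (d - 1))) ^ 2) := by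
          refine Real.sqrt_le_sqrt ?_
          calc (d : ℝ) ^ 2 * (5 ^ (d - 1) * d) = 5 ^ (d - 1) * (d : ℝ) ^ 3 := by ring
            _ ≤ 8 ^ (d - 1) * (2 ^ (d - 1)) ^ 3 := by gcongr; norm_num
            _ = (2 ^ (3 * (d - 1))) ^ 2 := by
                rw [show (8 : ℝ) = 2 ^ 3 by norm_num, ← pow_mul, ← pow_mul, ← pow_mul, ← pow_add]
                congr 1
                ring
      _ = _ := Real.sqrt_sq (by positivity)
  calc _ ≤ 24 * d * (Real.sqrt (5 ^ (d - 1)) * (5 * Real.sqrt d * R)) := by gcongr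
    _ = 120 * (d * (Real.sqrt (5 ^ (d - 1)) * Real.sqrt d)) * R := by ring
    _ ≤ _ := by gcongr

/-! ### Measurability and symmetrization -/

theorem measurable_maxFibre {d n : ℕ} (q : ℝ) (j : Fin d) :
    Measurable fun a : RealTensor d n => a.maxFibre q j :=
  Measurable.iSup fun i => (Finset.measurable_sum Finset.univ fun t _ =>
    (measurable_pi_apply (Function.update i j t)).pow_const 2).pow_const (q / 2)

theorem measurable_gridNorm {d n : ℕ} : Measurable fun a : RealTensor d n => a.gridNorm := by
  refine Measurable.iSup fun z => ?_
  have h : Measurable fun a : RealTensor d n => a.form fun k t => dyadicVal (z.1 k t) :=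
    Finset.measurable_sum _ fun i _ => (measurable_pi_apply i).mul_const _
  exact continuous_abs.measurable.comp h

theorem measurable_ofReal_gridNorm_rpow {d n : ℕ} (q : ℝ) :
    Measurable fun a : RealTensor d n => ENNReal.ofReal (a.gridNorm ^ q) :=
  (measurable_gridNorm.pow_const q).ennreal_ofReal

theorem lintegral_rpow_le_lintegral_rpow {Ω : Type*} [MeasurableSpace Ω] (P : Measure Ω)
    [IsProbabilityMeasure P] {g : Ω → ENNReal} (hg : Measurable g) {q : ℝ} (hq : 1 ≤ q) :
    (∫⁻ ω, g ω ∂P) ^ q ≤ ∫⁻ ω, g ω ^ q ∂P := by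
  have h := eLpNorm'_le_eLpNorm'_of_exponent_le one_pos hq P hg.aestronglyMeasurable
  simp only [eLpNorm', enorm_eq_self, ENNReal.rpow_one, div_one] at h
  refine (ENNReal.rpow_le_rpow h (by linarith)).trans_eq ?_
  rw [← ENNReal.rpow_mul, one_div_mul_cancel (by linarith), ENNReal.rpow_one]

theorem form_sub_mean_eq_integral {d n : ℕ} {Ω : Type*} [MeasurableSpace Ω] (P : Measure Ω)
    [IsProbabilityMeasure P] {A : Ω → RealTensor d n} {m : RealTensor d n}
    (hA : ∀ i, Integrable (fun ω => A ω i) P) (hm : ∀ i, ∫ ω, A ω i ∂P = m i)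
    (b : RealTensor d n) (y : Fin d → Fin n → ℝ) :
    (b - m).form y = ∫ ω, (b - A ω).form y ∂P := by
  have h : ∀ i, Integrable (fun ω => b i - A ω i) P := fun i => (integrable_const _).sub (hA i)
  simp only [form, Pi.sub_apply]
  rw [integral_finsetSum _ fun i _ => (h i).mul_const _]
  refine Finset.sum_congr rfl fun i _ => ?_
  rw [integral_mul_const, integral_sub (integrable_const _) (hA i), hm i]
  simp

/-- Jensen's inequality at a maximizing grid point, where the form is linear in the tensor. Working
in `ENNReal` avoids assuming finite `q`-th moments. -/
theorem ofReal_gridNorm_sub_mean_rpow_le {d n : ℕ} {Ω : Type*} [MeasurableSpace Ω]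
    (P : Measure Ω) [IsProbabilityMeasure P] {A : Ω → RealTensor d n} {m : RealTensor d n}
    (hAm : Measurable A) (hA : ∀ i, Integrable (fun ω => A ω i) P)
    (hm : ∀ i, ∫ ω, A ω i ∂P = m i) (b : RealTensor d n) {q : ℝ} (hq : 1 ≤ q) :
    ENNReal.ofReal ((b - m).gridNorm ^ q) ≤
      ∫⁻ ω, ENNReal.ofReal ((b - A ω).gridNorm ^ q) ∂P := by
  obtain ⟨z, hz⟩ := exists_eq_ciSup_of_finite
    (f := fun z : BoundedCode d n => |(b - m).form fun k t => dyadicVal (z.1 k t)|)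
  have h1 : ENNReal.ofReal (b - m).gridNorm ≤ ∫⁻ ω, ENNReal.ofReal (b - A ω).gridNorm ∂P := by
    rw [gridNorm, ← hz, form_sub_mean_eq_integral P hA hm, ← Real.norm_eq_abs, ofReal_norm]
    refine (enorm_integral_le_lintegral_enorm _).trans (lintegral_mono fun ω => ?_)
    simp only [← ofReal_norm, Real.norm_eq_abs]
    exact ENNReal.ofReal_le_ofReal (abs_form_le_gridNorm _ z)
  simp_rw [← ENNReal.ofReal_rpow_of_nonneg (gridNorm_nonneg _) (show 0 ≤ q by linarith)]
  refine (ENNReal.rpow_le_rpow h1 (by linarith)).trans (lintegral_rpow_le_lintegral_rpow P ?_ hq)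
  exact (measurable_gridNorm.comp (measurable_const.sub hAm)).ennreal_ofReal

/-- A sign `-1` at `i` amounts to swapping the `i`-th entries of the two copies, which preserves the
product measure. The entries need not have a common law. -/
theorem lintegral_pi_prod_sub_boolSign {ι : Type*} [Fintype ι] (ν : ι → Measure ℝ)
    [∀ i, IsProbabilityMeasure (ν i)] {F : (ι → ℝ) → ENNReal} (hF : Measurable F)
    (ε : ι → Bool) :
    ∫⁻ p, F (fun i => boolSign (ε i) * (p.1 i - p.2 i)) ∂((Measure.pi ν).prod (Measure.pi ν)) =
      ∫⁻ p, F (p.1 - p.2) ∂((Measure.pi ν).prod (Measure.pi ν)) := by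
  have he := measurePreserving_arrowProdEquivProdArrow ℝ ℝ ι ν ν
  have hs : MeasurePreserving (fun (c : ι → ℝ × ℝ) i => (if ε i then id else Prod.swap) (c i))
      (Measure.pi fun i => (ν i).prod (ν i)) (Measure.pi fun i => (ν i).prod (ν i)) := by
    refine measurePreserving_pi _ _ fun i => ?_
    cases ε i
    · exact Measure.measurePreserving_swap
    · exact MeasurePreserving.id _
  have hF1 : Measurable fun p : (ι → ℝ) × (ι → ℝ) => F (p.1 - p.2) :=
    hF.comp (measurable_fst.sub measurable_snd)
  have hF2 : Measurable fun p : (ι → ℝ) × (ι → ℝ) =>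
      F (fun i => boolSign (ε i) * (p.1 i - p.2 i)) := by
    refine hF.comp (measurable_pi_iff.2 fun i => measurable_const.mul ?_)
    exact ((measurable_pi_apply i).comp measurable_fst).sub
      ((measurable_pi_apply i).comp measurable_snd)
  rw [← he.lintegral_comp hF1, ← he.lintegral_comp hF2,
    ← hs.lintegral_comp (f := fun c => F (_ - _))
      (hF1.comp (MeasurableEquiv.arrowProdEquivProdArrow ℝ ℝ ι).measurable)]
  refine lintegral_congr fun c => ?_
  congr 1
  funext i
  simp only [MeasurableEquiv.arrowProdEquivProdArrow, MeasurableEquiv.coe_mk,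
    Equiv.arrowProdEquivProdArrow_apply, Pi.sub_apply]
  cases ε i <;> simp [boolSign]

theorem sum_ofReal_gridNorm_boolSign_sub_le {d n : ℕ} (hd : 1 ≤ d) (hn : 1 ≤ n)
    (a b : RealTensor d n) {q : ℝ} (hq : 1 ≤ q) :
    ∑ ε : (Fin d → Fin n) → Bool,
        ENNReal.ofReal (gridNorm (fun i => boolSign (ε i) * (a i - b i)) ^ q) ≤
      2 ^ Fintype.card (Fin d → Fin n) * (ENNReal.ofReal
        (3 * (4 * d * (Real.sqrt (5 ^ (d - 1)) * Real.sqrt (chainEntropy d n q))) ^ q) *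
        ((∑ j, ENNReal.ofReal (a.maxFibre q j)) + ∑ j, ENNReal.ofReal (b.maxFibre q j))) := by
  have h1 := sum_gridNorm_boolSign_rpow_le hd (a - b) hq
  have h2 := sum_fibreNorm_sub_rpow_le hd hn a b hq
  set K := Real.sqrt (5 ^ (d - 1)) * Real.sqrt (chainEntropy d n q) with hK
  have hK0 : 0 ≤ K := by positivity
  have hS0 : 0 ≤ ∑ j, fibreNorm (a - b) j := Finset.sum_nonneg fun j _ => fibreNorm_nonneg _ j
  rw [← ENNReal.ofReal_sum_of_nonneg fun ε _ => Real.rpow_nonneg (gridNorm_nonneg _) _,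
    ← ENNReal.ofReal_sum_of_nonneg fun j _ => a.maxFibre_nonneg q j,
    ← ENNReal.ofReal_sum_of_nonneg fun j _ => b.maxFibre_nonneg q j,
    ← ENNReal.ofReal_add (Finset.sum_nonneg fun j _ => a.maxFibre_nonneg q j)
      (Finset.sum_nonneg fun j _ => b.maxFibre_nonneg q j),
    ← ENNReal.ofReal_mul (by positivity),
    show (2 : ENNReal) ^ Fintype.card (Fin d → Fin n) =
      ENNReal.ofReal (2 ^ Fintype.card (Fin d → Fin n)) by
        rw [ENNReal.ofReal_pow (by norm_num)]; simp,
    ← ENNReal.ofReal_mul (by positivity)]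
  refine ENNReal.ofReal_le_ofReal (h1.trans ?_)
  calc _ = 3 * 2 ^ q * 2 ^ Fintype.card (Fin d → Fin n) *
        (K ^ q * (∑ j, fibreNorm (a - b) j) ^ q) := by rw [← Real.mul_rpow hK0 hS0]
    _ ≤ 3 * 2 ^ q * 2 ^ Fintype.card (Fin d → Fin n) *
        (K ^ q * ((2 * d) ^ q * ((∑ j, a.maxFibre q j) + ∑ j, b.maxFibre q j))) := by gcongr
    _ = _ := by
        rw [show (4 : ℝ) * d * K = 2 * K * (2 * d) by ring,
          Real.mul_rpow (x := 2 * K) (by positivity) (by positivity),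
          Real.mul_rpow (x := 2) (y := K) (by norm_num) hK0]
        ring

theorem lintegral_gridNorm_sub_le {d n : ℕ} (hd : 1 ≤ d) (hn : 1 ≤ n)
    (ν : (Fin d → Fin n) → Measure ℝ) [∀ i, IsProbabilityMeasure (ν i)] {q : ℝ} (hq : 1 ≤ q) :
    ∫⁻ p : RealTensor d n × RealTensor d n, ENNReal.ofReal (gridNorm (p.1 - p.2) ^ q)
        ∂((Measure.pi ν).prod (Measure.pi ν)) ≤
      ENNReal.ofReal
        (3 * (4 * d * (Real.sqrt (5 ^ (d - 1)) * Real.sqrt (chainEntropy d n q))) ^ q) *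
        (2 * ∑ j, ∫⁻ a, ENNReal.ofReal (RealTensor.maxFibre a q j) ∂(Measure.pi ν)) := by
  have hH : ∀ j : Fin d, Measurable fun a : RealTensor d n => ENNReal.ofReal (a.maxFibre q j) :=
    fun j => (measurable_maxFibre q j).ennreal_ofReal
  have hHs : Measurable fun a : RealTensor d n => ∑ j, ENNReal.ofReal (a.maxFibre q j) :=
    Finset.measurable_sum _ fun j _ => hH j
  have hF := measurable_ofReal_gridNorm_rpow (d := d) (n := n) q
  set N := Fintype.card (Fin d → Fin n) with hN
  set C := ENNReal.ofReal
    (3 * (4 * d * (Real.sqrt (5 ^ (d - 1)) * Real.sqrt (chainEntropy d n q))) ^ q) with hC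
  set Q := (Measure.pi ν).prod (Measure.pi ν) with hQ
  have h2 : (2 : ENNReal) ^ N ≠ 0 := by simp
  have h2' : (2 : ENNReal) ^ N ≠ ⊤ := by simp
  -- Multiplying by the number of sign patterns turns the average over signs into a finite sum.
  rw [← ENNReal.mul_le_mul_iff_right h2 h2']
  calc 2 ^ N * ∫⁻ p, ENNReal.ofReal (gridNorm (p.1 - p.2) ^ q) ∂Q
      = ∑ ε : (Fin d → Fin n) → Bool, ∫⁻ p : RealTensor d n × RealTensor d n,
          ENNReal.ofReal (gridNorm (fun i => boolSign (ε i) * (p.1 i - p.2 i)) ^ q) ∂Q := by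
        rw [Finset.sum_congr rfl fun ε _ => lintegral_pi_prod_sub_boolSign ν hF ε]
        rw [Finset.sum_const, Finset.card_univ, Fintype.card_fun, Fintype.card_bool, nsmul_eq_mul]
        push_cast
        rfl
    _ = ∫⁻ p : RealTensor d n × RealTensor d n, ∑ ε : (Fin d → Fin n) → Bool,
          ENNReal.ofReal (gridNorm (fun i => boolSign (ε i) * (p.1 i - p.2 i)) ^ q) ∂Q := by
        refine (lintegral_finsetSum _ fun ε _ => ?_).symm
        refine hF.comp (measurable_pi_iff.2 fun i => measurable_const.mul ?_)
        exact ((measurable_pi_apply i).comp measurable_fst).sub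
          ((measurable_pi_apply i).comp measurable_snd)
    _ ≤ ∫⁻ p : RealTensor d n × RealTensor d n, 2 ^ N * (C *
          ((∑ j, ENNReal.ofReal (p.1.maxFibre q j)) +
            ∑ j, ENNReal.ofReal (p.2.maxFibre q j))) ∂Q :=
        lintegral_mono fun p => sum_ofReal_gridNorm_boolSign_sub_le hd hn p.1 p.2 hq
    _ = 2 ^ N * (C * (2 * ∑ j, ∫⁻ a, ENNReal.ofReal (RealTensor.maxFibre a q j)
          ∂(Measure.pi ν))) := by
        rw [lintegral_const_mul' _ _ h2', lintegral_const_mul' _ _ ENNReal.ofReal_ne_top,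
          lintegral_add_left (f := fun p : RealTensor d n × RealTensor d n =>
            ∑ j, ENNReal.ofReal (p.1.maxFibre q j)) (hHs.comp measurable_fst),
          ← lintegral_finsetSum _ fun j _ => hH j, two_mul]
        congr 3
        · exact measurePreserving_fst.lintegral_comp hHs
        · exact measurePreserving_snd.lintegral_comp hHs

end RealTensor

/-! ### Assembly of the main theorem -/

theorem mainTheorem1 :
    ∃ c : ℝ, 0 < c ∧
      ∀ (d n : ℕ) (_ : 1 ≤ d) (_ : 1 ≤ n) (q : ℝ) (_ : 1 ≤ q)
        (Ω : Type*) [MeasurableSpace Ω] (P : Measure Ω) [IsProbabilityMeasure P]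
        (A : Ω → RealTensor d n) (Ahat : RealTensor d n)
        (_ : ∀ i, Measurable fun ω => A ω i)
        (_ : iIndepFun (fun (i : Fin d → Fin n) (ω : Ω) => A ω i) P)
        (_ : ∀ i, Integrable (fun ω => A ω i) P)
        (_ : ∀ i, ∫ ω, A ω i ∂P = Ahat i),
        (∫⁻ ω, ENNReal.ofReal ((A ω - Ahat).spectralNorm ^ q) ∂P) ^ (1 / q) ≤
          ENNReal.ofReal
              (c * 2 ^ (3 * (d - 1)) * (Real.sqrt (d * Real.log n) + Real.sqrt q)) *
            (∑ j : Fin d, ∫⁻ ω, ENNReal.ofReal ((A ω).maxFibre q j) ∂P) ^ (1 / q) := by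
  refine ⟨120, by norm_num, ?_⟩
  intro d n hd hn q hq Ω _ P _ A Ahat hmeas hind hint hmean
  have hq0 : 0 < q := by linarith
  have hA : Measurable A := measurable_pi_iff.2 hmeas
  set ν : (Fin d → Fin n) → Measure ℝ := fun i => P.map fun ω => A ω i with hν
  have hνp : ∀ i, IsProbabilityMeasure (ν i) := fun i =>
    Measure.isProbabilityMeasure_map (hmeas i).aemeasurable
  have hmap : P.map A = Measure.pi ν :=
    (iIndepFun_iff_map_fun_eq_pi_map fun i => (hmeas i).aemeasurable).1 hind
  have hF := RealTensor.measurable_ofReal_gridNorm_rpow (d := d) (n := n) q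
  set K := Real.sqrt (5 ^ (d - 1)) * Real.sqrt (RealTensor.chainEntropy d n q) with hK
  set S := ∑ j : Fin d, ∫⁻ ω, ENNReal.ofReal ((A ω).maxFibre q j) ∂P with hS
  have hS' : ∑ j, ∫⁻ a, ENNReal.ofReal (RealTensor.maxFibre a q j) ∂(Measure.pi ν) = S := by
    rw [← hmap]
    exact Finset.sum_congr rfl fun j _ =>
      lintegral_map (RealTensor.measurable_maxFibre q j).ennreal_ofReal hA
  have hsub : ∫⁻ ω, ∫⁻ ω', ENNReal.ofReal ((A ω - A ω').gridNorm ^ q) ∂P ∂P =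
      ∫⁻ p : RealTensor d n × RealTensor d n,
        ENNReal.ofReal (RealTensor.gridNorm (p.1 - p.2) ^ q)
          ∂((Measure.pi ν).prod (Measure.pi ν)) := by
    have hG : Measurable fun p : RealTensor d n × RealTensor d n =>
        ENNReal.ofReal (RealTensor.gridNorm (p.1 - p.2) ^ q) :=
      hF.comp (measurable_fst.sub measurable_snd)
    rw [lintegral_prod _ hG.aemeasurable, ← hmap, lintegral_map hG.lintegral_prod_right' hA]
    refine lintegral_congr fun ω => ?_
    exact (lintegral_map (hG.comp measurable_prodMk_left) hA).symm
  have hmain : ∫⁻ ω, ENNReal.ofReal ((A ω - Ahat).spectralNorm ^ q) ∂P ≤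
      ENNReal.ofReal (24 * d * K) ^ q * S := by
    calc _ ≤ ∫⁻ ω, ∫⁻ ω', ENNReal.ofReal ((A ω - A ω').gridNorm ^ q) ∂P ∂P := by
          refine lintegral_mono fun ω => le_trans (ENNReal.ofReal_le_ofReal ?_)
            (RealTensor.ofReal_gridNorm_sub_mean_rpow_le P hA hint hmean (A ω) hq)
          refine Real.rpow_le_rpow (Real.sSup_nonneg ?_)
            (RealTensor.spectralNorm_le_gridNorm _) hq0.le
          rintro r ⟨x, -, rfl⟩
          exact abs_nonneg _
      _ ≤ ENNReal.ofReal (3 * (4 * d * K) ^ q) * (2 * S) := by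
          rw [hsub, ← hS']
          exact RealTensor.lintegral_gridNorm_sub_le hd hn ν hq
      _ = ENNReal.ofReal (6 * (4 * d * K) ^ q) * S := by
          rw [← mul_assoc, ← ENNReal.ofReal_ofNat 2, ← ENNReal.ofReal_mul (by positivity)]
          congr 2
          ring
      _ ≤ ENNReal.ofReal (24 * d * K) ^ q * S := by
          refine mul_le_mul' ?_ le_rfl
          rw [ENNReal.ofReal_rpow_of_nonneg (by positivity) hq0.le]
          refine ENNReal.ofReal_le_ofReal ?_
          rw [show (24 : ℝ) * d * K = 6 * (4 * d * K) by ring,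
            Real.mul_rpow (x := 6) (y := 4 * d * K) (by norm_num) (by positivity)]
          refine mul_le_mul_of_nonneg_right ?_ (by positivity)
          -- The `6` combines the `3` of the maximal inequality and the `2` of the two copies; `6 ≤
          -- 6 ^ q` moves it inside the power.
          exact Real.self_le_rpow_of_one_le (by norm_num) hq
  calc _ ≤ (ENNReal.ofReal (24 * d * K) ^ q * S) ^ (1 / q) :=
        ENNReal.rpow_le_rpow hmain (by positivity)
    _ = ENNReal.ofReal (24 * d * K) * S ^ (1 / q) := by
        rw [ENNReal.mul_rpow_of_nonneg (ENNReal.ofReal (24 * d * K) ^ q) S (one_div_nonneg.2 hq0.le), ← ENNReal.rpow_mul,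
          mul_one_div_cancel hq0.ne', ENNReal.rpow_one]
    _ ≤ _ := by
        refine mul_le_mul' (ENNReal.ofReal_le_ofReal ?_) le_rfl
        exact RealTensor.mul_sqrt_chainEntropy_le hd hn hq
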